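/- Let $d,N,s\ge 0$ and $p\ge 0$ be integers and let $f^{[1]},\dots,f^{[N]}:\mathbb R^d\to\mathbb R^d$. A non-standard additive Runge--Kutta (NSARK) method with coefficient functions $a_{ij}^{[\nu]}(y,\Delta t)$, $b_j^{[\nu]}(y,\Delta t)\in\mathbb R$ ($i,j=1,\dots,s$, $\nu=1,\dots,N$; arbitrary functions of $y\in\mathbb R^d$ and of the step size $\Delta t$), applied to the autonomous system $y'=\sum_{\nu=1}^N f^{[\nu]}(y)$, is $$y^{(i)}=y^n+\Delta t\sum_{j=1}^s\sum_{\nu=1}^N a_{ij}^{[\nu]}(y^n,\Delta t)f^{[\nu]}(y^{(j)}),\quad i=1,\dots,s,\qquad y^{n+1}=y^n+\Delta t\sum_{j=1}^s\sum_{\nu=1}^N b_{j}^{[\nu]}(y^n,\Delta t)f^{[\nu]}(y^{(j)}).$$ Let $NT$ be the set of finite rooted trees with nodes colored in $\{1,\dots,N\}$ (children unordered). Write $\tau=[\tau_1,\dots,\tau_k]^{[\mu]}$ for the tree with root color $\mu$ and children $\tau_1,\dots,\tau_k$ ($k=0$ is the one-node tree), $|\tau|$ for the number of nodes, and $NT_p=\{\tau\in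 NT:|\tau|\le p\}$. If the children of $\tau$ are $m_1$ copies of $\theta_1$, …, $m_r$ copies of $\theta_r$ with pairwise different $\theta_j$, put $\sigma(\tau)=\prod_{j=1}^r m_j!\,\sigma(\theta_j)^{m_j}$; so $\sigma=1$ on one-node trees. The elementary differentials are $$\mathcal F([\tau_1,\dots,\tau_k]^{[\mu]})(y)=\sum_{i_1,\dots,i_k=1}^d\partial_{i_1\cdots i_k}f^{[\mu]}(y)\,\mathcal F_{i_1}(\tau_1)(y)\cdots\mathcal F_{i_k}(\tau_k)(y),$$ which is $f^{[\mu]}(y)$ for $k=0$. Define recursively, with $\delta$ the Kronecker delta and all coefficients evaluated at $(y,\Delta t)$, $$g_i^{[\nu]}([\tau_1,\dots,\tau_k]^{[\mu]},y,\Delta t)=\delta_{\nu\mu}\prod_{m=1}^k d_i(\tau_m,y,\Delta t),\qquad d_i(\tau,y,\Delta t)=\sum_{\nu=1}^N\sum_{j=1}^s a_{ij}^{[\nu]}\,g_j^{[\nu]}(\tau,y,\Delta t),$$ $$u(\tau,y,\Delta t)=\sum_{\nu=1}^N\sum_{i=1}^s b_i^{[\nu]}\,g_i^{[\nu]}(\tau,y,\Delta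 t),$$ where the empty product is $1$. **Theorem.** Fix $y^n\in\mathbb R^d$. Suppose that each $f^{[\nu]}$ is of class $C^{p+1}$ and Lipschitz continuous on $\mathbb R^d$, that $a_{ij}^{[\nu]}(y^n,\Delta t)=O(1)$ as $\Delta t\to0^+$ for all $i,j,\nu$, and that for all sufficiently small $\Delta t>0$ the stage equations have a solution. Then every family of solutions $y^{(1)},\dots,y^{(s)}$ of the stage equations (one solution for each sufficiently small $\Delta t>0$) satisfies, as $\Delta t\to0^+$, for all $i=1,\dots,s$ and $\nu=1,\dots,N$, $$y^{(i)}=y^n+\sum_{\tau\in NT_p}\frac{\Delta t^{|\tau|}}{\sigma(\tau)}d_i(\tau,y^n,\Delta t)\,\mathcal F(\tau)(y^n)+O(\Delta t^{p+1}),$$ $$\Delta t\,f^{[\nu]}(y^{(i)})=\sum_{\tau\in NT_p}\frac{\Delta t^{|\tau|}}{\sigma(\tau)}g_i^{[\nu]}(\tau,y^n,\Delta t)\,\mathcal F(\tau)(y^n)+O(\Delta t^{p+1}).$$ If moreover $b_j^{[\nu]}(y^n,\Delta t)=O(1)$ as $\Delta t\to0^+$ for all $j,\nu$, then also $$y^{n+1}=y^n+\sum_{\tau\in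 NT_p}\frac{\Delta t^{|\tau|}}{\sigma(\tau)}u(\tau,y^n,\Delta t)\,\mathcal F(\tau)(y^n)+O(\Delta t^{p+1}).$$ -/

import Mathlib

open Filter Topology Asymptotics
open scoped Nat

noncomputable section

/-- Finite rooted trees with nodes colored in `Fin N`, in which the children of every node are
listed in some order. -/
inductive OrderedTree (N : ℕ) : Type
  | node (ν : Fin N) (k : ℕ) (child : Fin k → OrderedTree N) : OrderedTree N

namespace OrderedTree

variable {N : ℕ}

/-- Two ordered trees are isomorphic as colored rooted trees: equal root colors, and the children
are pairwise isomorphic after a permutation. -/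
def Iso : OrderedTree N → OrderedTree N → Prop
  | node μ k c, node ν l c' => μ = ν ∧ ∃ e : Fin k ≃ Fin l, ∀ i, Iso (c i) (c' (e i))

theorem Iso.refl : ∀ t : OrderedTree N, Iso t t
  | node _ _ c => ⟨rfl, Equiv.refl _, fun i => Iso.refl (c i)⟩

theorem Iso.symm : ∀ {t t' : OrderedTree N}, Iso t t' → Iso t' t
  | node _ _ _, node _ _ c', ⟨h, e, H⟩ =>
    ⟨h.symm, e.symm, fun i => Iso.symm (by
      have := H (e.symm i)
      rwa [e.apply_symm_apply] at this)⟩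

theorem Iso.trans : ∀ {t t' t'' : OrderedTree N}, Iso t t' → Iso t' t'' → Iso t t''
  | node _ _ _, node _ _ _, node _ _ _, ⟨h, e, H⟩, ⟨h', e', H'⟩ =>
    ⟨h.trans h', e.trans e', fun i => Iso.trans (H i) (H' (e i))⟩

instance setoid (N : ℕ) : Setoid (OrderedTree N) where
  r := Iso
  iseqv := ⟨Iso.refl, Iso.symm, Iso.trans⟩

/-- The number of nodes. -/
def order : OrderedTree N → ℕ
  | node _ _ c => 1 + ∑ i, order (c i)

open Classical in
/-- The symmetry: if, up to isomorphism, the children are `τ₁` (`m₁` times), …, `τᵣ` (`mᵣ` times)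
with pairwise different `τⱼ`, the value is `∏ⱼ mⱼ! σ(τⱼ) ^ mⱼ`. -/
def symmetry : OrderedTree N → ℕ
  | node _ _ c =>
    (∏ C ∈ Finset.univ.image (fun i => (⟦c i⟧ : Quotient (setoid N))),
      (Finset.univ.filter (fun i => (⟦c i⟧ : Quotient (setoid N)) = C)).card !) *
    ∏ i, symmetry (c i)

/-- The elementary differential: `F([τ₁,…,τₖ]^[ν])(y)` is the `k`-th derivative of `f^[ν]` at `y`
evaluated at the vectors `F(τ₁)(y), …, F(τₖ)(y)`, that is
`∑ ∂_{i₁…iₖ} f^[ν](y) F_{i₁}(τ₁)(y) ⋯ F_{iₖ}(τₖ)(y)`. -/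
def elemDiff {d : ℕ} (f : Fin N → EuclideanSpace ℝ (Fin d) → EuclideanSpace ℝ (Fin d)) :
    OrderedTree N → EuclideanSpace ℝ (Fin d) → EuclideanSpace ℝ (Fin d)
  | node ν k c, y => iteratedFDeriv ℝ k (f ν) y (fun i => elemDiff f (c i) y)

/-- The coefficients `g_i^[ν]` for a tableau with entries `A ν i j`: on a tree with root color `μ`
and children `τ₁, …, τₖ` the value is `δ_{νμ} ∏ₘ d_i(τₘ)` with
`d_i(τ) = ∑_κ ∑_j A κ i j * g_j^[κ](τ)`. -/
def g {s : ℕ} (A : Fin N → Fin s → Fin s → ℝ) : OrderedTree N → Fin s → Fin N → ℝ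
  | node μ _ c, i, ν =>
    (if ν = μ then 1 else 0) * ∏ m, ∑ κ, ∑ j, A κ i j * g A (c m) j κ

theorem order_congr : ∀ {t t' : OrderedTree N}, Iso t t' → order t = order t'
  | node _ _ c, node _ _ c', ⟨_, e, H⟩ => by
    simp only [order]
    rw [Fintype.sum_equiv e (fun i => order (c i)) (fun i => order (c' i))
      (fun i => order_congr (H i))]

theorem symmetry_congr : ∀ {t t' : OrderedTree N}, Iso t t' → symmetry t = symmetry t'
  | node _ _ c, node _ _ c', ⟨_, e, H⟩ => by
    classical
    have hq : ∀ i, (⟦c i⟧ : Quotient (setoid N)) = ⟦c' (e i)⟧ := fun i => Quotient.sound (H i)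
    simp only [symmetry]
    rw [Fintype.prod_equiv e (fun i => symmetry (c i)) (fun i => symmetry (c' i))
      (fun i => symmetry_congr (H i))]
    congr 1
    have himg : Finset.univ.image (fun i => (⟦c i⟧ : Quotient (setoid N))) =
        Finset.univ.image (fun i => (⟦c' i⟧ : Quotient (setoid N))) := by
      ext C
      simp only [Finset.mem_image, Finset.mem_univ, true_and, hq]
      exact ⟨fun ⟨i, hi⟩ => ⟨e i, hi⟩, fun ⟨i, hi⟩ => ⟨e.symm i, by simpa using hi⟩⟩
    rw [himg]
    refine Finset.prod_congr rfl fun C _ => ?_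
    congr 1
    refine Finset.card_equiv e fun i => ?_
    simp [hq]

theorem g_congr {s : ℕ} (A : Fin N → Fin s → Fin s → ℝ) :
    ∀ {t t' : OrderedTree N}, Iso t t' → g A t = g A t'
  | node _ _ c, node _ _ c', ⟨h, e, H⟩ => by
    funext i ν
    simp only [g, h]
    congr 1
    refine Fintype.prod_equiv e _ _ fun m => ?_
    rw [g_congr A (H m)]

theorem finite_order_le (q : ℕ) : {t : OrderedTree N | order t ≤ q}.Finite := by
  induction q with
  | zero =>
    refine Set.Finite.subset Set.finite_empty ?_
    rintro ⟨ν, k, c⟩ h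
    simp [order] at h
  | succ q ih =>
    have hfin : (⋃ ν : Fin N, ⋃ k ∈ Set.Iic q,
        (fun c => node ν k c) '' (Set.pi Set.univ fun _ : Fin k => {t | order t ≤ q})).Finite :=
      Set.finite_iUnion fun ν => (Set.finite_Iic q).biUnion fun k _ =>
        (Set.Finite.pi fun _ => ih).image _
    refine hfin.subset ?_
    rintro ⟨ν, k, c⟩ h
    have hsum : ∑ i, order (c i) ≤ q := by
      have h' : 1 + ∑ i, order (c i) ≤ q + 1 := h
      omega
    have hpos : ∀ t : OrderedTree N, 1 ≤ order t := by
      rintro ⟨ν, k, c⟩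
      simp [order]
    have hk : k ≤ q := by
      have : ∑ _i : Fin k, 1 ≤ ∑ i, order (c i) := Finset.sum_le_sum fun i _ => hpos _
      simp at this
      omega
    simp only [Set.mem_iUnion]
    refine ⟨ν, k, hk, c, fun i _ => ?_, rfl⟩
    exact (Finset.single_le_sum (f := fun i => order (c i)) (fun _ _ => Nat.zero_le _)
      (Finset.mem_univ i)).trans hsum

end OrderedTree

/-- The set `NT` of colored rooted trees (`N`-trees): the order of the children is forgotten. -/
def ColoredTree (N : ℕ) : Type := Quotient (OrderedTree.setoid N)

namespace ColoredTree

variable {N : ℕ}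

/-- The order `|τ|`, the number of nodes. -/
def order (τ : ColoredTree N) : ℕ :=
  Quotient.lift OrderedTree.order (fun _ _ h => OrderedTree.order_congr h) τ

/-- The symmetry `σ(τ)`. -/
def symmetry (τ : ColoredTree N) : ℕ :=
  Quotient.lift OrderedTree.symmetry (fun _ _ h => OrderedTree.symmetry_congr h) τ

/-- The elementary differential `F(τ)`. Derivatives of smooth maps are symmetric multilinear maps,
so the ordering of the children chosen by `Quotient.out` is immaterial. -/
def elemDiff {d : ℕ} (f : Fin N → EuclideanSpace ℝ (Fin d) → EuclideanSpace ℝ (Fin d))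
    (τ : ColoredTree N) : EuclideanSpace ℝ (Fin d) → EuclideanSpace ℝ (Fin d) :=
  OrderedTree.elemDiff f (Quotient.out τ)

theorem finite_order_le (q : ℕ) : {τ : ColoredTree N | order τ ≤ q}.Finite := by
  refine ((OrderedTree.finite_order_le (N := N) q).image
    (fun t => (Quotient.mk _ t : ColoredTree N))).subset ?_
  rintro ⟨t⟩ h
  exact ⟨t, h, rfl⟩

/-- The set `NT_q` of colored rooted trees with at most `q` nodes. -/
def upTo (N q : ℕ) : Finset (ColoredTree N) := (finite_order_le (N := N) q).toFinset

end ColoredTree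

/-- The sum `∑_{τ ∈ NT_p} Δt^|τ| / σ(τ) * w(τ) F(τ)(y)`, so that `y + nbSum f p w y Δt` is the
NB-series with coefficients `w` truncated at order `p`. -/
def nbSum {d N : ℕ} (f : Fin N → EuclideanSpace ℝ (Fin d) → EuclideanSpace ℝ (Fin d)) (p : ℕ)
    (w : ColoredTree N → ℝ) (y : EuclideanSpace ℝ (Fin d)) (Δt : ℝ) : EuclideanSpace ℝ (Fin d) :=
  ∑ τ ∈ ColoredTree.upTo N p, (Δt ^ τ.order / (τ.symmetry : ℝ) * w τ) • τ.elemDiff f y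

/-- A non-standard additive Runge--Kutta method with `s` stages for right-hand sides split into `N`
addends on `ℝ^d`: the Butcher coefficients `a_{ij}^[ν](y, Δt)` and `b_j^[ν](y, Δt)` are arbitrary
functions of the current approximation and the step size. -/
structure NSARK (d N s : ℕ) where
  /-- the coefficients `a_{ij}^[ν](y, Δt)`, written `a ν i j y Δt` -/
  a : Fin N → Fin s → Fin s → EuclideanSpace ℝ (Fin d) → ℝ → ℝ
  /-- the coefficients `b_j^[ν](y, Δt)`, written `b ν j y Δt` -/
  b : Fin N → Fin s → EuclideanSpace ℝ (Fin d) → ℝ → ℝ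

namespace NSARK

variable {d N s : ℕ}

/-- `Y` solves the stage equations
`Y i = y + Δt ∑_j ∑_ν a_{ij}^[ν](y, Δt) f^[ν](Y j)`, `i = 1, …, s`. -/
def IsStageSolution (M : NSARK d N s)
    (f : Fin N → EuclideanSpace ℝ (Fin d) → EuclideanSpace ℝ (Fin d))
    (y : EuclideanSpace ℝ (Fin d)) (Δt : ℝ) (Y : Fin s → EuclideanSpace ℝ (Fin d)) : Prop :=
  ∀ i, Y i = y + Δt • ∑ j, ∑ ν, M.a ν i j y Δt • f ν (Y j)

/-- The output `y + Δt ∑_j ∑_ν b_j^[ν](y, Δt) f^[ν](Y j)` of one step with the stages `Y`. -/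
def output (M : NSARK d N s)
    (f : Fin N → EuclideanSpace ℝ (Fin d) → EuclideanSpace ℝ (Fin d))
    (y : EuclideanSpace ℝ (Fin d)) (Δt : ℝ) (Y : Fin s → EuclideanSpace ℝ (Fin d)) :
    EuclideanSpace ℝ (Fin d) :=
  y + Δt • ∑ j, ∑ ν, M.b ν j y Δt • f ν (Y j)

/-- The coefficient `g_i^[ν](τ, y, Δt)`. -/
def g (M : NSARK d N s) (i : Fin s) (ν : Fin N) (τ : ColoredTree N)
    (y : EuclideanSpace ℝ (Fin d)) (Δt : ℝ) : ℝ :=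
  Quotient.lift (OrderedTree.g fun κ i j => M.a κ i j y Δt)
    (fun _ _ h => OrderedTree.g_congr _ h) τ i ν

/-- The coefficient `d_i(τ, y, Δt) = ∑_ν ∑_j a_{ij}^[ν](y, Δt) g_j^[ν](τ, y, Δt)`. -/
def stageCoeff (M : NSARK d N s) (i : Fin s) (τ : ColoredTree N)
    (y : EuclideanSpace ℝ (Fin d)) (Δt : ℝ) : ℝ :=
  ∑ ν, ∑ j, M.a ν i j y Δt * M.g j ν τ y Δt

/-- The coefficient `u(τ, y, Δt) = ∑_ν ∑_i b_i^[ν](y, Δt) g_i^[ν](τ, y, Δt)`. -/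
def u (M : NSARK d N s) (τ : ColoredTree N) (y : EuclideanSpace ℝ (Fin d)) (Δt : ℝ) : ℝ :=
  ∑ ν, ∑ i, M.b ν i y Δt * M.g i ν τ y Δt

/-- The recursion `g_i^[ν]([τ₁,…,τₖ]^[μ]) = δ_{νμ} ∏ₘ d_i(τₘ)`. -/
theorem g_node (M : NSARK d N s) (i : Fin s) (ν μ : Fin N) (k : ℕ) (c : Fin k → OrderedTree N)
    (y : EuclideanSpace ℝ (Fin d)) (Δt : ℝ) :
    M.g i ν (Quotient.mk _ (OrderedTree.node μ k c)) y Δt =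
      (if ν = μ then 1 else 0) * ∏ m, M.stageCoeff i (Quotient.mk _ (c m)) y Δt :=
  rfl

end NSARK

end

/-!
Linear growth of the vector fields and bounded coefficients give the a priori estimate
`Y i = y + O(Δt)`. The expansions then follow by induction on the order. Suppose `Y i` agrees with
its truncated NB-series `y + z` up to `O(Δt ^ (q + 1))`. By strict differentiability at `y`,
replacing `Y i` by `y + z` in `Δt • f ν (Y i)` costs `O(Δt ^ (q + 2))`. Taylor's formula at `y` and
multilinear expansion of the derivatives along `z` then give a sum over tuples `(τ₁, …, τₖ)` of
trees, weighted by `1 / (k! ∏ σ(τₘ))`. By orbit-stabilizer for the permutations of the tuple, the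
children of a tree `τ` have `k! ∏ σ(τₘ) / σ(τ)` orderings, and these all give the same elementary
differential because derivatives are symmetric. Hence the tuples regroup into the NB-series with
coefficients `g` up to order `q + 1`, and inserting it into the stage equations raises the order
for the stages by one.
-/

section Calculus

theorem iteratedFDeriv_add_two_apply {𝕜 E F : Type*} [NontriviallyNormedField 𝕜]
    [NormedAddCommGroup E] [NormedSpace 𝕜 E] [NormedAddCommGroup F] [NormedSpace 𝕜 F] {f : E → F}
    {x : E} (k : ℕ) (v : Fin (k + 2) → E) :
    iteratedFDeriv 𝕜 (k + 2) f x v =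
      fderiv 𝕜 (fderiv 𝕜 (iteratedFDeriv 𝕜 k f)) x (v 0) (v 1) fun i => v i.succ.succ := by
  let uncurry : (E →L[𝕜] (E [×k]→L[𝕜] F)) ≃L[𝕜] (E [×(k + 1)]→L[𝕜] F) :=
    (continuousMultilinearCurryLeftEquiv 𝕜
      (fun _ : Fin (k + 1) => E) F).symm.toContinuousLinearEquiv
  exact congrArg (fun A : E →L[𝕜] (E [×(k + 1)]→L[𝕜] F) => A (v 0) (Fin.tail v))
    (uncurry.comp_fderiv (f := fderiv 𝕜 (iteratedFDeriv 𝕜 k f)) (x := x))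

variable {𝕜 E F : Type*} [RCLike 𝕜] [NormedAddCommGroup E] [NormedSpace 𝕜 E]
  [NormedAddCommGroup F] [NormedSpace 𝕜 F] {f : E → F} {x : E}

theorem iteratedFDeriv_comp_swap_zero_one {k : ℕ} (hf : ContDiffAt 𝕜 (k + 2 : ℕ) f x)
    (v : Fin (k + 2) → E) :
    iteratedFDeriv 𝕜 (k + 2) f x (v ∘ Equiv.swap 0 1) = iteratedFDeriv 𝕜 (k + 2) f x v := by
  have hsymm : IsSymmSndFDerivAt 𝕜 (iteratedFDeriv 𝕜 k f) x :=
    (hf.iteratedFDeriv_right (m := 2) (by norm_cast; omega)).isSymmSndFDerivAt (by simp)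
  rw [iteratedFDeriv_add_two_apply, iteratedFDeriv_add_two_apply, hsymm]
  congr 1

theorem iteratedFDeriv_comp_adjacent_swap {k : ℕ} (hf : ContDiffAt 𝕜 (k + 1 : ℕ) f x)
    (v : Fin (k + 1) → E) (i : Fin k) :
    iteratedFDeriv 𝕜 (k + 1) f x (v ∘ Equiv.swap i.castSucc i.succ) =
      iteratedFDeriv 𝕜 (k + 1) f x v := by
  induction k generalizing x with
  | zero => exact i.elim0
  | succ k ih =>
    cases i using Fin.cases with
    | zero => exact iteratedFDeriv_comp_swap_zero_one hf v
    | succ j =>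
      have hdiff : DifferentiableAt 𝕜 (iteratedFDeriv 𝕜 (k + 1) f) x :=
        hf.differentiableAt_iteratedFDeriv (by norm_cast; omega)
      have hhead : (v ∘ Equiv.swap j.succ.castSucc j.succ.succ) 0 = v 0 :=
        congrArg v (Equiv.swap_apply_of_ne_of_ne
          (Fin.castSucc_ne_zero_iff.2 (Fin.succ_ne_zero j)).symm (Fin.succ_ne_zero _).symm)
      have htail : Fin.tail (v ∘ Equiv.swap j.succ.castSucc j.succ.succ) =
          Fin.tail v ∘ Equiv.swap j.castSucc j.succ := by
        funext l
        simp only [Fin.tail, Function.comp_apply, Fin.castSucc_succ,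
          (Fin.succ_injective _).map_swap]
      have hnear : (fun z => iteratedFDeriv 𝕜 (k + 1) f z
          (Fin.tail v ∘ Equiv.swap j.castSucc j.succ)) =ᶠ[𝓝 x] fun z =>
            iteratedFDeriv 𝕜 (k + 1) f z (Fin.tail v) := by
        filter_upwards [hf.eventually (by simp)] with z hz
        exact ih (hz.of_le (by norm_cast; omega)) _ j
      rw [hdiff.iteratedFDeriv_succ_apply_left', hdiff.iteratedFDeriv_succ_apply_left', hhead,
        htail, hnear.fderiv_eq]

theorem iteratedFDeriv_comp_perm_of_contDiffAt {k : ℕ} (hf : ContDiffAt 𝕜 k f x) (v : Fin k → E)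
    (e : Equiv.Perm (Fin k)) :
    iteratedFDeriv 𝕜 k f x (v ∘ e) = iteratedFDeriv 𝕜 k f x v := by
  cases k with
  | zero => exact congrArg _ (Subsingleton.elim _ _)
  | succ k =>
    have he : e ∈ Submonoid.closure (Set.range fun i : Fin k => Equiv.swap i.castSucc i.succ) := by
      rw [Equiv.Perm.mclosure_swap_castSucc_succ]
      exact Submonoid.mem_top e
    induction he using Submonoid.closure_induction generalizing v with
    | mem e he =>
      obtain ⟨i, rfl⟩ := he
      exact iteratedFDeriv_comp_adjacent_swap hf v i
    | one => rfl
    | mul e e' _ _ h h' => rw [Equiv.Perm.coe_mul, ← Function.comp_assoc, h', h]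

end Calculus

section Taylor

variable {E F : Type*} [NormedAddCommGroup E] [NormedSpace ℝ E]
  [NormedAddCommGroup F] [NormedSpace ℝ F] [CompleteSpace F] {f : E → F} {x : E}

theorem norm_sub_taylorPolynomial_le {n : ℕ} {C : ℝ} {z : E}
    (hf : ∀ t ∈ Set.Icc (0 : ℝ) 1, ContDiffAt ℝ (n + 1) f (x + t • z))
    (hC : ∀ t ∈ Set.Icc (0 : ℝ) 1, ‖iteratedFDeriv ℝ (n + 1) f (x + t • z)‖ ≤ C) :
    ‖f (x + z) - ∑ k ∈ Finset.range (n + 1), (k ! : ℝ)⁻¹ • iteratedFDeriv ℝ k f x fun _ => z‖ ≤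
      (n ! : ℝ)⁻¹ * (C * ‖z‖ ^ (n + 1)) := by
  have hintegrand : ∀ t ∈ Set.uIoc (0 : ℝ) 1,
      ‖(1 - t) ^ n • iteratedFDeriv ℝ (n + 1) f (x + t • z) fun _ => z‖ ≤ C * ‖z‖ ^ (n + 1) := by
    intro t ht
    rw [Set.uIoc_of_le zero_le_one] at ht
    have hweight : ‖(1 - t) ^ n‖ ≤ 1 := by
      rw [norm_pow, Real.norm_of_nonneg (by linarith [ht.2])]
      exact pow_le_one₀ (by linarith [ht.2]) (by linarith [ht.1])
    calc ‖(1 - t) ^ n • iteratedFDeriv ℝ (n + 1) f (x + t • z) fun _ => z‖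
        ≤ 1 * ‖iteratedFDeriv ℝ (n + 1) f (x + t • z) fun _ => z‖ := by
          rw [norm_smul]
          gcongr
      _ ≤ ‖iteratedFDeriv ℝ (n + 1) f (x + t • z)‖ * ‖z‖ ^ (n + 1) := by
          simpa using (iteratedFDeriv ℝ (n + 1) f (x + t • z)).le_opNorm fun _ => z
      _ ≤ C * ‖z‖ ^ (n + 1) := by
          gcongr
          exact hC t (Set.Ioc_subset_Icc_self ht)
  rw [map_add_eq_sum_add_integral_iteratedFDeriv hf, add_sub_cancel_left, norm_smul,
    Real.norm_of_nonneg (by positivity)]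
  gcongr
  simpa using intervalIntegral.norm_integral_le_of_norm_le_const hintegrand

theorem isBigO_sub_taylorPolynomial {n : ℕ} (hf : ContDiffAt ℝ n f x) :
    (fun z => f (x + z) -
      ∑ k ∈ Finset.range n, (k ! : ℝ)⁻¹ • iteratedFDeriv ℝ k f x fun _ => z)
      =O[𝓝 0] fun z => ‖z‖ ^ n := by
  cases n with
  | zero =>
    have hcont : Tendsto (fun z => f (x + z)) (𝓝 0) (𝓝 (f x)) :=
      hf.continuousAt.tendsto.comp (by simpa using (tendsto_id (x := 𝓝 (0 : E))).const_add x)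
    simpa using hcont.isBigO_one ℝ
  | succ n =>
    obtain ⟨r, hr, hball⟩ := Metric.eventually_nhds_iff_ball.1
      ((hf.eventually (by simp)).and
        ((hf.continuousAt_iteratedFDeriv le_rfl).norm.eventually_le_const (lt_add_one _)))
    refine IsBigO.of_bound ((n ! : ℝ)⁻¹ * (‖iteratedFDeriv ℝ (n + 1) f x‖ + 1)) ?_
    filter_upwards [Metric.ball_mem_nhds (0 : E) hr] with z hz
    have hsegment : ∀ t ∈ Set.Icc (0 : ℝ) 1, x + t • z ∈ Metric.ball x r := by
      rintro t ⟨ht₀, ht₁⟩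
      rw [mem_ball_iff_norm, add_sub_cancel_left, norm_smul, Real.norm_of_nonneg ht₀]
      exact (mul_le_of_le_one_left (norm_nonneg z) ht₁).trans_lt (mem_ball_zero_iff.1 hz)
    rw [norm_pow, norm_norm, mul_assoc]
    exact norm_sub_taylorPolynomial_le (fun t ht => by exact_mod_cast (hball _ (hsegment t ht)).1)
      fun t ht => (hball _ (hsegment t ht)).2

end Taylor

section Growth

variable {α E F : Type*} [SeminormedAddCommGroup E] [SeminormedAddCommGroup F]

theorem isBigO_pow_pow_of_le_nhds_zero {l : Filter ℝ} (hl : l ≤ 𝓝 0) {m n : ℕ} (hmn : m ≤ n) :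
    (fun t : ℝ => t ^ n) =O[l] fun t => t ^ m := by
  obtain rfl | hlt := hmn.eq_or_lt
  · exact isBigO_refl _ _
  · exact (isLittleO_pow_pow hlt).isBigO.mono hl

theorem isBigO_one_add_norm_of_lipschitzWith {K : NNReal} {f : E → F} (hf : LipschitzWith K f) :
    f =O[⊤] fun x => 1 + ‖x‖ := by
  refine IsBigO.of_bound (‖f 0‖ + K) (Eventually.of_forall fun x => ?_)
  have h : ‖f x‖ ≤ ‖f 0‖ + K * ‖x‖ := by
    simpa using (norm_le_norm_add_norm_sub' (f x) (f 0)).trans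
      (add_le_add_right (hf.norm_sub_le x 0) _)
  rw [Real.norm_of_nonneg (by positivity)]
  nlinarith [norm_nonneg (f 0), norm_nonneg x, K.coe_nonneg]

theorem isBigO_of_isBigO_mul_one_add_norm {l : Filter α} {h : α → ℝ} {u : α → E}
    (hh : Tendsto h l (𝓝 0)) (hu : u =O[l] fun a => h a * (1 + ‖u a‖)) : u =O[l] h := by
  obtain ⟨C, hC, hbound⟩ := hu.exists_pos
  refine IsBigO.of_bound (2 * C) ?_
  have hsmall : ∀ᶠ a in l, ‖h a‖ ≤ (2 * C)⁻¹ :=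
    hh.norm.eventually_le_const (by simpa using hC)
  filter_upwards [hbound.bound, hsmall] with a hua hha
  rw [norm_mul, Real.norm_of_nonneg (by positivity : 0 ≤ 1 + ‖u a‖)] at hua
  have hhalf : C * ‖h a‖ ≤ 1 / 2 := by
    calc C * ‖h a‖ ≤ C * (2 * C)⁻¹ := by gcongr
      _ = 1 / 2 := by field_simp
  nlinarith [norm_nonneg (u a)]

end Growth

section Orderings

theorem card_image_comp_perm_mul_card_stabilizer {ι α : Type*} [Fintype ι] [DecidableEq ι]
    [DecidableEq α] (c : ι → α) :
    (Finset.univ.image fun e : Equiv.Perm ι => c ∘ e).card *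
      Nat.card {e : Equiv.Perm ι // c ∘ e = c} = (Fintype.card ι)! := by
  rw [Nat.card_eq_fintype_card, Fintype.card_subtype, ← Fintype.card_perm, ← Finset.card_univ,
    Finset.card_eq_sum_card_image (fun e : Equiv.Perm ι => c ∘ e) Finset.univ]
  refine (Finset.sum_const_nat fun b hb => ?_).symm
  obtain ⟨e₀, -, rfl⟩ := Finset.mem_image.1 hb
  refine (Finset.card_equiv (Equiv.mulRight e₀) fun e => ?_).symm
  simp only [Finset.mem_filter, Finset.mem_univ, true_and, Equiv.coe_mulRight,
    Equiv.Perm.coe_mul, ← Function.comp_assoc]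
  exact e₀.surjective.injective_comp_right.eq_iff.symm

end Orderings

namespace OrderedTree

variable {N : ℕ}

theorem one_le_order : ∀ t : OrderedTree N, 1 ≤ order t
  | node _ _ _ => by simp [order]

theorem arity_lt_order_node (ν : Fin N) (k : ℕ) (c : Fin k → OrderedTree N) :
    k < order (node ν k c) := by
  have hsum : ∑ _i : Fin k, 1 ≤ ∑ i, order (c i) :=
    Finset.sum_le_sum fun i _ => one_le_order (c i)
  rw [Finset.sum_const, Finset.card_univ, Fintype.card_fin, smul_eq_mul, mul_one] at hsum
  rw [order]
  omega

theorem order_child_lt_order_node (ν : Fin N) (k : ℕ) (c : Fin k → OrderedTree N) (i : Fin k) :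
    order (c i) < order (node ν k c) := by
  have hsum : order (c i) ≤ ∑ j, order (c j) :=
    Finset.single_le_sum (f := fun j => order (c j)) (fun _ _ => Nat.zero_le _) (Finset.mem_univ i)
  rw [order]
  omega

theorem symmetry_node (ν : Fin N) (k : ℕ) (c : Fin k → OrderedTree N) :
    symmetry (node ν k c) =
      Nat.card {e : Equiv.Perm (Fin k) //
        (fun i => (⟦c i⟧ : Quotient (setoid N))) ∘ e = fun i => ⟦c i⟧} * ∏ i, symmetry (c i) := by
  classical
  rw [symmetry, Nat.card_eq_fintype_card, DomMulAct.stabilizer_card']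
  simp only [Fintype.card_subtype]

theorem elemDiff_congr {d n : ℕ}
    {f : Fin N → EuclideanSpace ℝ (Fin d) → EuclideanSpace ℝ (Fin d)}
    {y : EuclideanSpace ℝ (Fin d)} (hf : ∀ ν, ContDiffAt ℝ n (f ν) y) :
    ∀ {t t' : OrderedTree N}, Iso t t' → order t ≤ n + 1 → elemDiff f t y = elemDiff f t' y
  | node μ k c, node _ l c', ⟨rfl, e, hiso⟩, hn => by
    obtain rfl : k = l := by simpa using Fintype.card_congr e
    have hk : k ≤ n := by have := arity_lt_order_node μ k c; omega
    have hchild : (fun i => elemDiff f (c i) y) = (fun i => elemDiff f (c' i) y) ∘ e :=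
      funext fun i => elemDiff_congr hf (hiso i)
        ((order_child_lt_order_node μ k c i).le.trans hn)
    rw [elemDiff, elemDiff, hchild]
    exact iteratedFDeriv_comp_perm_of_contDiffAt ((hf μ).of_le (by exact_mod_cast hk)) _ e

end OrderedTree

namespace ColoredTree

variable {N : ℕ}

theorem mk_out (τ : ColoredTree N) : (Quotient.mk _ (Quotient.out τ) : ColoredTree N) = τ :=
  Quotient.out_eq τ

theorem order_out (τ : ColoredTree N) : OrderedTree.order (Quotient.out τ) = order τ :=
  congrArg order (mk_out τ)

theorem symmetry_out (τ : ColoredTree N) : OrderedTree.symmetry (Quotient.out τ) = symmetry τ :=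
  congrArg symmetry (mk_out τ)

theorem one_le_order (τ : ColoredTree N) : 1 ≤ order τ :=
  (OrderedTree.one_le_order _).trans_eq (order_out τ)

theorem mem_upTo {q : ℕ} {τ : ColoredTree N} : τ ∈ upTo N q ↔ order τ ≤ q := by
  simp [upTo]

theorem upTo_zero : upTo N 0 = ∅ :=
  Finset.eq_empty_of_forall_notMem fun τ hτ => (one_le_order τ).not_gt (by
    simpa [Nat.lt_one_iff] using mem_upTo.1 hτ)

/-- The tree `[c 0, …, c (k - 1)]^[ν]` with root color `ν` and children `c 0, …, c (k - 1)`. -/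
noncomputable def node (ν : Fin N) (k : ℕ) (c : Fin k → ColoredTree N) : ColoredTree N :=
  Quotient.mk _ (OrderedTree.node ν k fun i => Quotient.out (c i))

theorem mk_node (ν : Fin N) (k : ℕ) (c : Fin k → OrderedTree N) :
    (Quotient.mk _ (OrderedTree.node ν k c) : ColoredTree N) =
      node ν k fun i => Quotient.mk _ (c i) :=
  Quotient.sound ⟨rfl, Equiv.refl _, fun i =>
    (Quotient.exact (mk_out (Quotient.mk _ (c i)))).symm⟩

@[elab_as_elim]
theorem induction_on_node {motive : ColoredTree N → Prop} (τ : ColoredTree N)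
    (node : ∀ ν k c, (∀ i, motive (c i)) → motive (node ν k c)) : motive τ := by
  obtain ⟨t, rfl⟩ := Quotient.exists_rep τ
  induction t with
  | node ν k c ih => exact mk_node ν k c ▸ node ν k _ ih

theorem node_eq_node_iff {ν μ : Fin N} {k l : ℕ} {c : Fin k → ColoredTree N}
    {c' : Fin l → ColoredTree N} :
    node ν k c = node μ l c' ↔ ν = μ ∧ ∃ e : Fin k ≃ Fin l, c = c' ∘ e := by
  constructor
  · intro h
    obtain ⟨hroot, e, hiso⟩ := Quotient.exact h
    refine ⟨hroot, e, funext fun i => ?_⟩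
    rw [← mk_out (c i), Function.comp_apply, ← mk_out (c' (e i))]
    exact Quotient.sound (hiso i)
  · rintro ⟨rfl, e, rfl⟩
    exact Quotient.sound ⟨rfl, e, fun i => OrderedTree.Iso.refl _⟩

theorem order_node (ν : Fin N) (k : ℕ) (c : Fin k → ColoredTree N) :
    order (node ν k c) = 1 + ∑ i, order (c i) :=
  congrArg (1 + ·) (Finset.sum_congr rfl fun i _ => order_out (c i))

theorem arity_lt_order_node (ν : Fin N) (k : ℕ) (c : Fin k → ColoredTree N) :
    k < order (node ν k c) :=
  OrderedTree.arity_lt_order_node ν k _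

theorem order_child_lt_order_node (ν : Fin N) (k : ℕ) (c : Fin k → ColoredTree N) (i : Fin k) :
    order (c i) < order (node ν k c) :=
  (order_out (c i)).symm.trans_lt
    (OrderedTree.order_child_lt_order_node ν k (fun j => Quotient.out (c j)) i)

theorem symmetry_node (ν : Fin N) (k : ℕ) (c : Fin k → ColoredTree N) :
    symmetry (node ν k c) =
      Nat.card {e : Equiv.Perm (Fin k) // c ∘ e = c} * ∏ i, symmetry (c i) := by
  have hout : (fun i => (Quotient.mk _ (Quotient.out (c i)) : ColoredTree N)) = c :=
    funext fun i => mk_out (c i)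
  refine (OrderedTree.symmetry_node ν k fun i => Quotient.out (c i)).trans ?_
  exact congrArg₂ (· * ·) (congrArg (fun c' : Fin k → ColoredTree N =>
    Nat.card {e : Equiv.Perm (Fin k) // c' ∘ e = c'}) hout)
    (Finset.prod_congr rfl fun i _ => symmetry_out (c i))

theorem elemDiff_node {d n : ℕ}
    {f : Fin N → EuclideanSpace ℝ (Fin d) → EuclideanSpace ℝ (Fin d)}
    {y : EuclideanSpace ℝ (Fin d)} (hf : ∀ ν, ContDiffAt ℝ n (f ν) y) {ν : Fin N} {k : ℕ}
    {c : Fin k → ColoredTree N} (h : order (node ν k c) ≤ n + 1) :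
    elemDiff f (node ν k c) y = iteratedFDeriv ℝ k (f ν) y fun i => elemDiff f (c i) y :=
  OrderedTree.elemDiff_congr hf (Quotient.exact (mk_out (node ν k c))) ((order_out _).trans_le h)

/-- The presentations `(ν, k, c)` of the trees `node ν k c` with at most `q + 1` nodes. A tree
occurs once for each ordering of its children. -/
noncomputable def presentations (N q : ℕ) : Finset (Σ _ : Fin N, Σ k : ℕ, Fin k → ColoredTree N) :=
  Finset.univ.sigma fun ν => (Finset.range (q + 1)).sigma fun k =>
    (Fintype.piFinset fun _ : Fin k => upTo N q).filter fun c => order (node ν k c) ≤ q + 1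

theorem mem_presentations {q : ℕ} {x : Σ _ : Fin N, Σ k : ℕ, Fin k → ColoredTree N} :
    x ∈ presentations N q ↔ order (node x.1 x.2.1 x.2.2) ≤ q + 1 := by
  obtain ⟨ν, k, c⟩ := x
  simp only [presentations, Finset.mem_sigma, Finset.mem_univ, Finset.mem_range, Finset.mem_filter,
    Fintype.mem_piFinset, mem_upTo, true_and]
  refine ⟨fun h => h.2.2, fun h => ⟨(arity_lt_order_node ν k c).trans_le h, fun i => ?_, h⟩⟩
  exact Nat.lt_succ_iff.1 ((order_child_lt_order_node ν k c i).trans_le h)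

open Classical in
theorem filter_presentations_node_eq {q : ℕ} {ν : Fin N} {k : ℕ} {c : Fin k → ColoredTree N}
    (h : order (node ν k c) ≤ q + 1) :
    ((presentations N q).filter fun x => node x.1 x.2.1 x.2.2 = node ν k c) =
      (Finset.univ.image fun e : Equiv.Perm (Fin k) => c ∘ e).image fun c' => ⟨ν, k, c'⟩ := by
  ext ⟨μ, l, c'⟩
  simp only [Finset.mem_filter, mem_presentations, Finset.mem_image, Finset.mem_univ, true_and,
    exists_exists_eq_and]
  constructor
  · rintro ⟨-, hnode⟩
    obtain ⟨rfl, e, rfl⟩ := node_eq_node_iff.1 hnode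
    obtain rfl : l = k := by simpa using Fintype.card_congr e
    exact ⟨e, rfl⟩
  · rintro ⟨e, hx⟩
    cases hx
    have hnode : node ν k (c ∘ e) = node ν k c := node_eq_node_iff.2 ⟨rfl, e, rfl⟩
    exact ⟨hnode ▸ h, hnode⟩

open Classical in
theorem card_filter_presentations_mul_symmetry {q : ℕ} {ν : Fin N} {k : ℕ}
    {c : Fin k → ColoredTree N} (h : order (node ν k c) ≤ q + 1) :
    ((presentations N q).filter fun x => node x.1 x.2.1 x.2.2 = node ν k c).card *
      symmetry (node ν k c) = k ! * ∏ i, symmetry (c i) := by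
  have hinj : Function.Injective fun c' : Fin k → ColoredTree N =>
      (⟨ν, k, c'⟩ : Σ _ : Fin N, Σ k : ℕ, Fin k → ColoredTree N) :=
    sigma_mk_injective.comp sigma_mk_injective
  rw [filter_presentations_node_eq h, Finset.card_image_of_injective _ hinj, symmetry_node,
    ← mul_assoc, card_image_comp_perm_mul_card_stabilizer, Fintype.card_fin]

theorem factorial_mul_prod_symmetry_congr {ν μ : Fin N} {k l : ℕ} {c : Fin k → ColoredTree N}
    {c' : Fin l → ColoredTree N} (h : node ν k c = node μ l c') :
    k ! * ∏ i, symmetry (c i) = l ! * ∏ i, symmetry (c' i) := by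
  obtain ⟨-, e, rfl⟩ := node_eq_node_iff.1 h
  obtain rfl : k = l := by simpa using Fintype.card_congr e
  exact congrArg _ (Equiv.prod_comp e fun i => symmetry (c' i))

theorem symmetry_pos (τ : ColoredTree N) : 0 < symmetry τ := by
  induction τ using induction_on_node with
  | node ν k c ih =>
    rw [symmetry_node]
    have : Nonempty {e : Equiv.Perm (Fin k) // c ∘ e = c} := ⟨1, rfl⟩
    exact mul_pos Nat.card_pos (Finset.prod_pos fun i _ => ih i)

open Classical in
theorem sum_filter_presentations_inv {𝕜 : Type*} [Field 𝕜] [CharZero 𝕜] {q : ℕ}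
    {τ : ColoredTree N} (hτ : τ ∈ upTo N (q + 1)) :
    ∑ x ∈ presentations N q with node x.1 x.2.1 x.2.2 = τ,
      ((x.2.1 ! * ∏ i, symmetry (x.2.2 i) : ℕ) : 𝕜)⁻¹ = (symmetry τ : 𝕜)⁻¹ := by
  induction τ using induction_on_node with
  | node ν k c =>
    have hcard := card_filter_presentations_mul_symmetry (mem_upTo.1 hτ)
    have hpos : 0 < k ! * ∏ i, symmetry (c i) :=
      mul_pos (Nat.factorial_pos k) (Finset.prod_pos fun i _ => symmetry_pos (c i))
    rw [Finset.sum_congr rfl fun x hx => by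
        rw [factorial_mul_prod_symmetry_congr (Finset.mem_filter.1 hx).2],
      Finset.sum_const, nsmul_eq_mul, ← hcard, Nat.cast_mul]
    have hcard_ne := left_ne_zero_of_mul (hcard.trans_ne hpos.ne')
    rw [mul_inv, mul_inv_cancel_left₀ (Nat.cast_ne_zero.2 hcard_ne)]

theorem sum_upTo_succ {𝕜 V : Type*} [Field 𝕜] [CharZero 𝕜] [AddCommGroup V] [Module 𝕜 V] (q : ℕ)
    (Φ : ColoredTree N → V) :
    ∑ τ ∈ upTo N (q + 1), (symmetry τ : 𝕜)⁻¹ • Φ τ =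
      ∑ x ∈ presentations N q,
        ((x.2.1 ! * ∏ i, symmetry (x.2.2 i) : ℕ) : 𝕜)⁻¹ • Φ (node x.1 x.2.1 x.2.2) := by
  classical
  rw [← Finset.sum_fiberwise_of_maps_to (t := upTo N (q + 1))
    (g := fun x => node x.1 x.2.1 x.2.2) fun x hx => mem_upTo.2 (mem_presentations.1 hx)]
  refine Finset.sum_congr rfl fun τ hτ => ?_
  rw [← sum_filter_presentations_inv hτ, Finset.sum_smul]
  exact Finset.sum_congr rfl fun x hx => by rw [(Finset.mem_filter.1 hx).2]

end ColoredTree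

section NBSeries

variable {d N : ℕ} {f : Fin N → EuclideanSpace ℝ (Fin d) → EuclideanSpace ℝ (Fin d)}
  {y : EuclideanSpace ℝ (Fin d)} {l : Filter ℝ}

theorem nbSum_zero (w : ColoredTree N → ℝ) (Δt : ℝ) : nbSum f 0 w y Δt = 0 := by
  rw [nbSum, ColoredTree.upTo_zero, Finset.sum_empty]

theorem nbSum_sum {ι : Type*} (s : Finset ι) (q : ℕ) (w : ι → ColoredTree N → ℝ) (Δt : ℝ) :
    nbSum f q (fun τ => ∑ i ∈ s, w i τ) y Δt = ∑ i ∈ s, nbSum f q (w i) y Δt := by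
  simp only [nbSum, Finset.mul_sum, Finset.sum_smul]
  exact Finset.sum_comm

theorem nbSum_const_mul (q : ℕ) (a : ℝ) (w : ColoredTree N → ℝ) (Δt : ℝ) :
    nbSum f q (fun τ => a * w τ) y Δt = a • nbSum f q w y Δt := by
  simp only [nbSum, Finset.smul_sum, smul_smul, mul_left_comm a]

theorem isBigO_nbSum (hl : l ≤ 𝓝 0) {w : ColoredTree N → ℝ → ℝ}
    (hw : ∀ τ, w τ =O[l] fun _ => (1 : ℝ)) (q : ℕ) :
    (fun Δt => nbSum f q (fun τ => w τ Δt) y Δt) =O[l] fun Δt => Δt := by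
  refine IsBigO.fun_sum fun τ _ => ?_
  have hpow : (fun Δt : ℝ => Δt ^ τ.order) =O[l] fun Δt => Δt := by
    simpa only [pow_one] using isBigO_pow_pow_of_le_nhds_zero hl τ.one_le_order
  have hcoeff := (hpow.const_mul_left (τ.symmetry : ℝ)⁻¹).mul (hw τ)
  simpa only [div_eq_inv_mul, mul_one, smul_eq_mul] using
    hcoeff.smul (isBigO_const_const (τ.elemDiff f y) (one_ne_zero (α := ℝ)) l)

/-- The contribution of the children `c 0, …, c (k - 1)`, in this order, to the `k`-th Taylor term
of `Δt f^[ν]` at `y` when the increment is the NB-series with coefficients `w`. -/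
noncomputable def taylorTerm (f : Fin N → EuclideanSpace ℝ (Fin d) → EuclideanSpace ℝ (Fin d))
    (w : ColoredTree N → ℝ) (y : EuclideanSpace ℝ (Fin d)) (ν : Fin N) (k : ℕ)
    (c : Fin k → ColoredTree N) (Δt : ℝ) : EuclideanSpace ℝ (Fin d) :=
  (((k ! * ∏ m, (c m).symmetry : ℕ) : ℝ)⁻¹ *
    (Δt ^ (ColoredTree.node ν k c).order * ∏ m, w (c m))) •
      iteratedFDeriv ℝ k (f ν) y fun m => (c m).elemDiff f y

theorem isBigO_taylorTerm {w : ColoredTree N → ℝ → ℝ} (hw : ∀ τ, w τ =O[l] fun _ => (1 : ℝ))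
    (ν : Fin N) (k : ℕ) (c : Fin k → ColoredTree N) :
    (fun Δt => taylorTerm f (fun τ => w τ Δt) y ν k c Δt)
      =O[l] fun Δt => Δt ^ (ColoredTree.node ν k c).order := by
  have hprod : (fun Δt => ∏ m, w (c m) Δt) =O[l] fun _ => (1 : ℝ) := by
    simpa only [Finset.prod_const_one] using
      IsBigO.finsetProd (s := Finset.univ) fun m _ => hw (c m)
  have hcoeff := ((isBigO_refl (fun Δt : ℝ => Δt ^ (ColoredTree.node ν k c).order) l).mul
    hprod).const_mul_left ((k ! * ∏ m, (c m).symmetry : ℕ) : ℝ)⁻¹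
  simpa only [taylorTerm, mul_one, smul_eq_mul] using hcoeff.smul (isBigO_const_const
    (iteratedFDeriv ℝ k (f ν) y fun m => (c m).elemDiff f y) (one_ne_zero (α := ℝ)) l)

theorem smul_iteratedFDeriv_nbSum (q : ℕ) (w : ColoredTree N → ℝ) (ν : Fin N) (k : ℕ) (Δt : ℝ) :
    Δt • (k ! : ℝ)⁻¹ • iteratedFDeriv ℝ k (f ν) y (fun _ => nbSum f q w y Δt) =
      ∑ c ∈ Fintype.piFinset fun _ : Fin k => ColoredTree.upTo N q,
        taylorTerm f w y ν k c Δt := by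
  simp only [nbSum]
  rw [ContinuousMultilinearMap.map_sum_finset, Finset.smul_sum, Finset.smul_sum]
  refine Finset.sum_congr rfl fun c _ => ?_
  rw [ContinuousMultilinearMap.map_smul_univ, taylorTerm, smul_smul, smul_smul]
  congr 1
  rw [Finset.prod_mul_distrib, Finset.prod_div_distrib, Finset.prod_pow_eq_pow_sum,
    ColoredTree.order_node, pow_add, pow_one, Nat.cast_mul, Nat.cast_prod, mul_inv]
  ring

theorem nbSum_succ_eq_sum_taylorTerm {q : ℕ} (hf : ∀ ν, ContDiffAt ℝ q (f ν) y)
    {w v : ColoredTree N → ℝ} {ν : Fin N}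
    (hv : ∀ μ k c, v (ColoredTree.node μ k c) = (if ν = μ then 1 else 0) * ∏ m, w (c m)) (Δt : ℝ) :
    nbSum f (q + 1) v y Δt = ∑ k ∈ Finset.range (q + 1),
      ∑ c ∈ (Fintype.piFinset fun _ : Fin k => ColoredTree.upTo N q) with
        (ColoredTree.node ν k c).order ≤ q + 1, taylorTerm f w y ν k c Δt := by
  have hweight : nbSum f (q + 1) v y Δt = ∑ τ ∈ ColoredTree.upTo N (q + 1),
      (τ.symmetry : ℝ)⁻¹ • (Δt ^ τ.order * v τ) • τ.elemDiff f y :=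
    Finset.sum_congr rfl fun τ _ => by rw [smul_smul, div_eq_inv_mul, mul_assoc]
  rw [hweight, ColoredTree.sum_upTo_succ, ColoredTree.presentations, Finset.sum_sigma,
    Finset.sum_eq_single_of_mem ν (Finset.mem_univ ν), Finset.sum_sigma]
  · refine Finset.sum_congr rfl fun k _ => Finset.sum_congr rfl fun c hc => ?_
    rw [hv, if_pos rfl, one_mul, smul_smul, taylorTerm,
      ColoredTree.elemDiff_node hf (Finset.mem_filter.1 hc).2]
  · refine fun μ _ hμ => Finset.sum_eq_zero fun x _ => ?_
    rw [hv, if_neg hμ.symm, zero_mul, mul_zero, zero_smul, smul_zero]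

theorem isBigO_smul_taylorPolynomial_sub_nbSum (hl : l ≤ 𝓝 0) {q : ℕ}
    (hf : ∀ ν, ContDiffAt ℝ q (f ν) y) {w v : ColoredTree N → ℝ → ℝ}
    (hw : ∀ τ, w τ =O[l] fun _ => (1 : ℝ)) {ν : Fin N}
    (hv : ∀ μ k c Δt, v (ColoredTree.node μ k c) Δt =
      (if ν = μ then 1 else 0) * ∏ m, w (c m) Δt) :
    (fun Δt => Δt • ∑ k ∈ Finset.range (q + 1), (k ! : ℝ)⁻¹ • iteratedFDeriv ℝ k (f ν) y
        (fun _ => nbSum f q (fun τ => w τ Δt) y Δt) - nbSum f (q + 1) (fun τ => v τ Δt) y Δt)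
      =O[l] fun Δt => Δt ^ (q + 2) := by
  have hsub : ∀ Δt, Δt • ∑ k ∈ Finset.range (q + 1), (k ! : ℝ)⁻¹ • iteratedFDeriv ℝ k (f ν) y
        (fun _ => nbSum f q (fun τ => w τ Δt) y Δt) - nbSum f (q + 1) (fun τ => v τ Δt) y Δt =
      ∑ k ∈ Finset.range (q + 1),
        ∑ c ∈ (Fintype.piFinset fun _ : Fin k => ColoredTree.upTo N q) with
          ¬(ColoredTree.node ν k c).order ≤ q + 1, taylorTerm f (fun τ => w τ Δt) y ν k c Δt := by
    intro Δt
    rw [nbSum_succ_eq_sum_taylorTerm (w := fun τ => w τ Δt) (v := fun τ => v τ Δt) (ν := ν) hf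
      fun μ k c => hv μ k c Δt, Finset.smul_sum, ← Finset.sum_sub_distrib]
    refine Finset.sum_congr rfl fun k _ => ?_
    rw [smul_iteratedFDeriv_nbSum, sub_eq_iff_eq_add', Finset.sum_filter_add_sum_filter_not]
  simp only [hsub]
  refine IsBigO.fun_sum fun k _ => IsBigO.fun_sum fun c hc => ?_
  exact (isBigO_taylorTerm hw ν k c).trans
    (isBigO_pow_pow_of_le_nhds_zero hl (not_le.1 (Finset.mem_filter.1 hc).2))

theorem isBigO_smul_comp_nbSum_sub_nbSum (hl : l ≤ 𝓝 0) {q : ℕ}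
    (hf : ∀ ν, ContDiffAt ℝ (q + 1 : ℕ) (f ν) y) {w v : ColoredTree N → ℝ → ℝ}
    (hw : ∀ τ, w τ =O[l] fun _ => (1 : ℝ)) {ν : Fin N}
    (hv : ∀ μ k c Δt, v (ColoredTree.node μ k c) Δt =
      (if ν = μ then 1 else 0) * ∏ m, w (c m) Δt) :
    (fun Δt => Δt • f ν (y + nbSum f q (fun τ => w τ Δt) y Δt) -
      nbSum f (q + 1) (fun τ => v τ Δt) y Δt) =O[l] fun Δt => Δt ^ (q + 2) := by
  have hincrement := isBigO_nbSum (f := f) (y := y) hl hw q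
  have htaylor := ((isBigO_sub_taylorPolynomial (hf ν)).comp_tendsto
    (hincrement.trans_tendsto hl)).trans (hincrement.norm_left.pow (q + 1))
  have hsmul := (isBigO_refl (fun Δt : ℝ => Δt) l).smul htaylor
  simp only [Function.comp_apply, smul_eq_mul, ← pow_succ'] at hsmul
  have hpoly := isBigO_smul_taylorPolynomial_sub_nbSum hl
    (fun ν => (hf ν).of_le (by exact_mod_cast q.le_succ)) hw hv
  exact (hsmul.add hpoly).congr_left fun Δt => by rw [smul_sub, sub_add_sub_cancel]

end NBSeries

namespace NSARK

variable {d N s : ℕ} {M : NSARK d N s}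
  {f : Fin N → EuclideanSpace ℝ (Fin d) → EuclideanSpace ℝ (Fin d)}
  {y : EuclideanSpace ℝ (Fin d)} {l : Filter ℝ} {Y : ℝ → Fin s → EuclideanSpace ℝ (Fin d)}

theorem g_coloredTree_node (M : NSARK d N s) (i : Fin s) (ν μ : Fin N) (k : ℕ)
    (c : Fin k → ColoredTree N) (y : EuclideanSpace ℝ (Fin d)) (Δt : ℝ) :
    M.g i ν (ColoredTree.node μ k c) y Δt =
      (if ν = μ then 1 else 0) * ∏ m, M.stageCoeff i (c m) y Δt := by
  simp only [ColoredTree.node, g_node, ColoredTree.mk_out]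

theorem isBigO_stageCoeff_of_g
    (ha : ∀ ν i j, (fun Δt => M.a ν i j y Δt) =O[l] fun _ => (1 : ℝ)) {τ : ColoredTree N}
    (hg : ∀ i ν, (fun Δt => M.g i ν τ y Δt) =O[l] fun _ => (1 : ℝ)) (i : Fin s) :
    (fun Δt => M.stageCoeff i τ y Δt) =O[l] fun _ => (1 : ℝ) :=
  IsBigO.fun_sum fun ν _ => IsBigO.fun_sum fun j _ => by
    simpa only [mul_one] using (ha ν i j).mul (hg j ν)

theorem isBigO_g (ha : ∀ ν i j, (fun Δt => M.a ν i j y Δt) =O[l] fun _ => (1 : ℝ))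
    (τ : ColoredTree N) (i : Fin s) (ν : Fin N) :
    (fun Δt => M.g i ν τ y Δt) =O[l] fun _ => (1 : ℝ) := by
  induction τ using ColoredTree.induction_on_node generalizing i ν with
  | node μ k c ih =>
    simp only [g_coloredTree_node]
    refine IsBigO.const_mul_left ?_ _
    simpa only [Finset.prod_const_one] using
      IsBigO.finsetProd (s := Finset.univ) fun m _ => isBigO_stageCoeff_of_g ha (ih m) i

theorem isBigO_stageCoeff (ha : ∀ ν i j, (fun Δt => M.a ν i j y Δt) =O[l] fun _ => (1 : ℝ))
    (τ : ColoredTree N) (i : Fin s) :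
    (fun Δt => M.stageCoeff i τ y Δt) =O[l] fun _ => (1 : ℝ) :=
  isBigO_stageCoeff_of_g ha (isBigO_g ha τ) i

theorem isBigO_stage_sub (hl : l ≤ 𝓝 0) (hgrowth : ∀ ν, f ν =O[⊤] fun x => 1 + ‖x‖)
    (ha : ∀ ν i j, (fun Δt => M.a ν i j y Δt) =O[l] fun _ => (1 : ℝ))
    (hY : ∀ᶠ Δt in l, M.IsStageSolution f y Δt (Y Δt)) (i : Fin s) :
    (fun Δt => Y Δt i - y) =O[l] fun Δt => Δt := by
  let u : ℝ → Fin s → EuclideanSpace ℝ (Fin d) := fun Δt j => Y Δt j - y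
  have hstage_norm : ∀ j Δt, 1 + ‖Y Δt j‖ ≤ (1 + ‖y‖) * (1 + ‖u Δt‖) := fun j Δt => by
    have hsub : ‖Y Δt j - y‖ ≤ ‖u Δt‖ := norm_le_pi_norm (u Δt) j
    have hadd : ‖Y Δt j‖ ≤ ‖y‖ + ‖Y Δt j - y‖ := norm_le_norm_add_norm_sub' _ _
    nlinarith [norm_nonneg y, norm_nonneg (u Δt)]
  have hfield : ∀ ν j, (fun Δt => f ν (Y Δt j)) =O[l] fun Δt => 1 + ‖u Δt‖ := fun ν j =>
    ((hgrowth ν).comp_tendsto tendsto_top).trans <|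
      IsBigO.of_bound (1 + ‖y‖) <| Eventually.of_forall fun Δt => by
        simpa only [Function.comp_apply, Real.norm_of_nonneg (add_nonneg zero_le_one
          (norm_nonneg _))] using hstage_norm j Δt
  have hstage : ∀ j, (fun Δt => u Δt j) =O[l] fun Δt => Δt * (1 + ‖u Δt‖) := fun j => by
    have hsum : (fun Δt => ∑ m, ∑ ν, M.a ν j m y Δt • f ν (Y Δt m)) =O[l]
        fun Δt => 1 + ‖u Δt‖ :=
      IsBigO.fun_sum fun m _ => IsBigO.fun_sum fun ν _ => by
        simpa only [smul_eq_mul, one_mul] using (ha ν j m).smul (hfield ν m)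
    refine ((isBigO_refl (fun Δt : ℝ => Δt) l).smul hsum).congr' ?_ EventuallyEq.rfl
    filter_upwards [hY] with Δt hsol
    exact (sub_eq_of_eq_add' (hsol j)).symm
  exact isBigO_pi.1 (isBigO_of_isBigO_mul_one_add_norm hl (isBigO_pi.2 hstage)) i

theorem isBigO_smul_sum_sub_nbSum {q : ℕ} {c : Fin N → Fin s → ℝ → ℝ}
    (hc : ∀ ν j, c ν j =O[l] fun _ => (1 : ℝ))
    (hg : ∀ i ν, (fun Δt => Δt • f ν (Y Δt i) - nbSum f q (fun τ => M.g i ν τ y Δt) y Δt)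
      =O[l] fun Δt => Δt ^ (q + 1)) :
    (fun Δt => Δt • ∑ j, ∑ ν, c ν j Δt • f ν (Y Δt j) -
      nbSum f q (fun τ => ∑ ν, ∑ j, c ν j Δt * M.g j ν τ y Δt) y Δt)
      =O[l] fun Δt => Δt ^ (q + 1) := by
  have hsum : (fun Δt => ∑ ν, ∑ j, c ν j Δt •
      (Δt • f ν (Y Δt j) - nbSum f q (fun τ => M.g j ν τ y Δt) y Δt))
      =O[l] fun Δt => Δt ^ (q + 1) :=
    IsBigO.fun_sum fun ν _ => IsBigO.fun_sum fun j _ => by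
      simpa only [smul_eq_mul, one_mul] using (hc ν j).smul (hg j ν)
  refine hsum.congr_left fun Δt => ?_
  have hswap : ∑ j, ∑ ν, c ν j Δt • f ν (Y Δt j) = ∑ ν, ∑ j, c ν j Δt • f ν (Y Δt j) :=
    Finset.sum_comm
  rw [hswap]
  simp only [nbSum_sum, nbSum_const_mul, smul_sub, Finset.sum_sub_distrib, Finset.smul_sum,
    smul_comm Δt]

theorem isBigO_stage_sub_nbSum {q : ℕ}
    (ha : ∀ ν i j, (fun Δt => M.a ν i j y Δt) =O[l] fun _ => (1 : ℝ))
    (hY : ∀ᶠ Δt in l, M.IsStageSolution f y Δt (Y Δt))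
    (hg : ∀ i ν, (fun Δt => Δt • f ν (Y Δt i) - nbSum f q (fun τ => M.g i ν τ y Δt) y Δt)
      =O[l] fun Δt => Δt ^ (q + 1)) (i : Fin s) :
    (fun Δt => Y Δt i - (y + nbSum f q (fun τ => M.stageCoeff i τ y Δt) y Δt))
      =O[l] fun Δt => Δt ^ (q + 1) := by
  refine (isBigO_smul_sum_sub_nbSum (fun ν j => ha ν i j) hg).congr' ?_ EventuallyEq.rfl
  filter_upwards [hY] with Δt hsol
  rw [hsol i, add_sub_add_left_eq_sub]
  rfl

theorem isBigO_smul_sub_nbSum_succ (hl : l ≤ 𝓝 0) {q : ℕ}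
    (hf : ∀ ν, ContDiffAt ℝ (q + 1 : ℕ) (f ν) y)
    (ha : ∀ ν i j, (fun Δt => M.a ν i j y Δt) =O[l] fun _ => (1 : ℝ)) {i : Fin s}
    (hstage : (fun Δt => Y Δt i - (y + nbSum f q (fun τ => M.stageCoeff i τ y Δt) y Δt))
      =O[l] fun Δt => Δt ^ (q + 1)) (ν : Fin N) :
    (fun Δt => Δt • f ν (Y Δt i) - nbSum f (q + 1) (fun τ => M.g i ν τ y Δt) y Δt)
      =O[l] fun Δt => Δt ^ (q + 2) := by
  let z : ℝ → EuclideanSpace ℝ (Fin d) := fun Δt =>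
    nbSum f q (fun τ => M.stageCoeff i τ y Δt) y Δt
  have hcoeff : ∀ τ, (fun Δt => M.stageCoeff i τ y Δt) =O[l] fun _ => (1 : ℝ) := fun τ =>
    isBigO_stageCoeff ha τ i
  have hseries : Tendsto (fun Δt => y + z Δt) l (𝓝 y) := by
    simpa only [add_zero] using ((isBigO_nbSum hl hcoeff q).trans_tendsto hl).const_add y
  have hY_tendsto : Tendsto (fun Δt => Y Δt i) l (𝓝 y) := by
    have hpow : Tendsto (fun Δt : ℝ => Δt ^ (q + 1)) l (𝓝 0) :=
      ((continuous_pow (q + 1)).tendsto' 0 0 (zero_pow q.succ_ne_zero)).mono_left hl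
    have hsub : Tendsto (fun Δt => Y Δt i - (y + z Δt)) l (𝓝 0) := hstage.trans_tendsto hpow
    simpa only [sub_add_cancel, zero_add] using hsub.add hseries
  have hlocalLip : (fun Δt => f ν (Y Δt i) - f ν (y + z Δt)) =O[l] fun Δt => Δt ^ (q + 1) :=
    (((hf ν).hasStrictFDerivAt (by simp)).isBigO_sub.comp_tendsto
      (hY_tendsto.prodMk_nhds hseries)).trans hstage
  have hsmul := (isBigO_refl (fun Δt : ℝ => Δt) l).smul hlocalLip
  simp only [smul_eq_mul, ← pow_succ'] at hsmul
  refine (hsmul.add (isBigO_smul_comp_nbSum_sub_nbSum (v := fun τ Δt => M.g i ν τ y Δt) hl hf hcoeff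
    fun μ k c Δt => M.g_coloredTree_node i ν μ k c y Δt)).congr_left fun Δt => ?_
  rw [smul_sub, sub_add_sub_cancel]

theorem isBigO_smul_sub_nbSum (hl : l ≤ 𝓝 0) {q : ℕ} (hf : ∀ ν, ContDiffAt ℝ q (f ν) y)
    (hgrowth : ∀ ν, f ν =O[⊤] fun x => 1 + ‖x‖)
    (ha : ∀ ν i j, (fun Δt => M.a ν i j y Δt) =O[l] fun _ => (1 : ℝ))
    (hY : ∀ᶠ Δt in l, M.IsStageSolution f y Δt (Y Δt)) (i : Fin s) (ν : Fin N) :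
    (fun Δt => Δt • f ν (Y Δt i) - nbSum f q (fun τ => M.g i ν τ y Δt) y Δt)
      =O[l] fun Δt => Δt ^ (q + 1) := by
  induction q generalizing i ν with
  | zero =>
    have hY_tendsto : Tendsto (fun Δt => Y Δt i) l (𝓝 y) :=
      tendsto_sub_nhds_zero_iff.1 ((isBigO_stage_sub hl hgrowth ha hY i).trans_tendsto hl)
    have hbounded := ((hf ν).continuousAt.tendsto.comp hY_tendsto).isBigO_one ℝ
    simpa only [nbSum_zero, Function.comp_apply, sub_zero, zero_add, pow_one, smul_eq_mul,
      mul_one] using (isBigO_refl (fun Δt : ℝ => Δt) l).smul hbounded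
  | succ q ih =>
    have hg := ih fun ν => (hf ν).of_le (by exact_mod_cast q.le_succ)
    exact isBigO_smul_sub_nbSum_succ hl hf ha (isBigO_stage_sub_nbSum ha hY hg i) ν

end NSARK

theorem mainTheorem1_general {d N s : ℕ} (p : ℕ) (M : NSARK d N s)
    (f : Fin N → EuclideanSpace ℝ (Fin d) → EuclideanSpace ℝ (Fin d))
    (y : EuclideanSpace ℝ (Fin d)) (hf : ∀ ν, ContDiffAt ℝ p (f ν) y)
    (hgrowth : ∀ ν, f ν =O[⊤] fun x => 1 + ‖x‖) {l : Filter ℝ} (hl : l ≤ 𝓝 0)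
    (ha : ∀ ν i j, (fun Δt => M.a ν i j y Δt) =O[l] fun _ => (1 : ℝ))
    (Y : ℝ → Fin s → EuclideanSpace ℝ (Fin d))
    (hY : ∀ᶠ Δt in l, M.IsStageSolution f y Δt (Y Δt)) :
    (∀ i, (fun Δt => Y Δt i - (y + nbSum f p (fun τ => M.stageCoeff i τ y Δt) y Δt))
      =O[l] fun Δt => Δt ^ (p + 1)) ∧
    (∀ i ν, (fun Δt => Δt • f ν (Y Δt i) - nbSum f p (fun τ => M.g i ν τ y Δt) y Δt)
      =O[l] fun Δt => Δt ^ (p + 1)) ∧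
    ((∀ ν j, (fun Δt => M.b ν j y Δt) =O[l] fun _ => (1 : ℝ)) →
      (fun Δt => M.output f y Δt (Y Δt) - (y + nbSum f p (fun τ => M.u τ y Δt) y Δt))
        =O[l] fun Δt => Δt ^ (p + 1)) := by
  have hg := NSARK.isBigO_smul_sub_nbSum hl hf hgrowth ha hY
  refine ⟨NSARK.isBigO_stage_sub_nbSum ha hY hg, hg, fun hb => ?_⟩
  simpa only [NSARK.output, NSARK.u, add_sub_add_left_eq_sub] using
    NSARK.isBigO_smul_sum_sub_nbSum hb hg

theorem mainTheorem1 {d N s : ℕ} (p : ℕ) (M : NSARK d N s)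
    (f : Fin N → EuclideanSpace ℝ (Fin d) → EuclideanSpace ℝ (Fin d))
    (hf : ∀ ν, ContDiff ℝ ((p + 1 : ℕ) : WithTop ℕ∞) (f ν))
    (hLip : ∀ ν, ∃ K, LipschitzWith K (f ν))
    (y : EuclideanSpace ℝ (Fin d))
    (ha : ∀ ν i j, (fun Δt : ℝ => M.a ν i j y Δt) =O[𝓝[>] 0] (fun _ => (1 : ℝ)))
    (Y : ℝ → Fin s → EuclideanSpace ℝ (Fin d))
    (hY : ∀ᶠ Δt : ℝ in 𝓝[>] 0, M.IsStageSolution f y Δt (Y Δt)) :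
    (∀ i, (fun Δt : ℝ => Y Δt i - (y + nbSum f p (fun τ => M.stageCoeff i τ y Δt) y Δt))
      =O[𝓝[>] 0] (fun Δt => Δt ^ (p + 1))) ∧
    (∀ i ν, (fun Δt : ℝ => Δt • f ν (Y Δt i) - nbSum f p (fun τ => M.g i ν τ y Δt) y Δt)
      =O[𝓝[>] 0] (fun Δt => Δt ^ (p + 1))) ∧
    ((∀ ν j, (fun Δt : ℝ => M.b ν j y Δt) =O[𝓝[>] 0] (fun _ => (1 : ℝ))) →
      (fun Δt : ℝ => M.output f y Δt (Y Δt) - (y + nbSum f p (fun τ => M.u τ y Δt) y Δt))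
        =O[𝓝[>] 0] (fun Δt => Δt ^ (p + 1))) := by
  choose K hK using hLip
  exact mainTheorem1_general p M f y
    (fun ν => (hf ν).contDiffAt.of_le (by exact_mod_cast p.le_succ))
    (fun ν => isBigO_one_add_norm_of_lipschitzWith (hK ν)) nhdsWithin_le_nhds ha Y hY
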